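/- Let $X$ be a complex Banach space and let $A$ be the generator of a bounded strongly continuous semigroup $(e^{tA})_{t\ge 0}$ on $X$. Let $\gamma>0$ and $v\in X$. Function classes. For a function or tempered distribution on $\mathbb R$ let $\mathcal F$ be the Fourier transform normalized by $\mathcal F h(s)=\frac1{2\pi}\int_{-\infty}^{\infty}e^{-ixs}h(x)\,dx$ for $h\in L^1(\mathbb R)$. Let $\mathcal M_+$ be the set of continuous functions $h:\mathbb R\to\mathbb C$ with $\mathcal F h\in L^1(\mathbb R)$ (in the sense of tempered distributions) and $\operatorname{supp}\mathcal F h\subseteq[0,\infty)$. "Holomorphic for $\operatorname{Re}z\le 0$" means holomorphic in $\operatorname{Re}z<0$ and continuous on $\operatorname{Re}z\le0$. Let $\widetilde{\mathcal M}$ be the set of functions $f$ that are holomorphic and bounded for $\operatorname{Re}z\le0$ and whose restriction $f_{(0)}(\xi)=f(i\xi)$, $\xi\in\mathbb R$, to the imaginary axis belongs to $\mathcal M_+$. For $f\in\widetilde{\mathcal M}$ put \[ f(A)x=\int_0^\infty e^{sA}x\;\mathcal F f_{(0)}(s)\,ds,\qquad x\in X . \] Let $\mathcal M_0$ be the set of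 functions $f$ holomorphic for $\operatorname{Re}z\le0$ such that $f(z)/(1-z)^n\in\widetilde{\mathcal M}$ for some integer $n\ge0$, and for such $f$ put \[ f(A)=(1-A)^n\Bigl(\frac{f(z)}{(1-z)^n}\Bigr)(A) \] on its natural domain, where $n$ is the least such integer (any other admissible $n$ gives the same operator). Finally, let $\mathcal M$ be the set of all $f\in\mathcal M_0$ for which $f(A)$ is defined on all of $X$ and bounded. Theorem. The number $\gamma$ belongs to the resolvent set of $A$, and for every $f\in\mathcal M$ we have \[ f(A)v\in\overline{\mathcal K_\infty((\gamma-A)^{-1},v)},\qquad \mathcal K_\infty((\gamma-A)^{-1},v)=\operatorname{span}\{v,(\gamma-A)^{-1}v,(\gamma-A)^{-2}v,\ldots\}. \] Consequently $f(A)v$ can be approximated to arbitrary precision in the spaces $\mathcal K_n((\gamma-A)^{-1},v)=\operatorname{span}\{v,(\gamma-A)^{-1}v,\ldots,(\gamma-A)^{-n+1}v\}$: for every $\varepsilon>0$ there is $n_0$ such that for all $n\ge n_0$ some $w\in\mathcal K_n((\gamma-A)^{-1},v)$ satisfies $\|f(A)v-w\|<\varepsilon$. -/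

import Mathlib

open MeasureTheory Filter Topology
open scoped NNReal SchwartzMap

namespace ResolventKrylov

noncomputable section

/-! ### Partially defined operators: `z - A`, maximal composition, powers, resolvent -/

section PartialOperators

/-- Composition `B ∘ A` of unbounded operators on its natural (maximal) domain
`{x ∈ D(A) | A x ∈ D(B)}`. -/
def compMax {X : Type*} [AddCommGroup X] [Module ℂ X] (B A : X →ₗ.[ℂ] X) : X →ₗ.[ℂ] X where
  domain :=
    { carrier := {x | ∃ h : x ∈ A.domain, A ⟨x, h⟩ ∈ B.domain}
      zero_mem' := ⟨A.domain.zero_mem, by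
        have h : (⟨0, A.domain.zero_mem⟩ : A.domain) = 0 := rfl
        rw [h, A.map_zero]; exact B.domain.zero_mem⟩
      add_mem' := by
        rintro a b ⟨ha, ha'⟩ ⟨hb, hb'⟩
        refine ⟨A.domain.add_mem ha hb, ?_⟩
        have h : (⟨a + b, A.domain.add_mem ha hb⟩ : A.domain) = ⟨a, ha⟩ + ⟨b, hb⟩ := rfl
        rw [h, A.map_add]
        exact B.domain.add_mem ha' hb'
      smul_mem' := by
        rintro c a ⟨ha, ha'⟩
        refine ⟨A.domain.smul_mem c ha, ?_⟩
        have h : (⟨c • a, A.domain.smul_mem c ha⟩ : A.domain) = c • ⟨a, ha⟩ := rfl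
        rw [h, A.map_smul]
        exact B.domain.smul_mem c ha' }
  toFun :=
    { toFun := fun x => B ⟨A ⟨x.1, x.2.choose⟩, x.2.choose_spec⟩
      map_add' := by
        intro x y
        rw [← B.map_add]
        congr 1
        apply Subtype.ext
        change A _ = A _ + A _
        rw [← A.map_add]
        rfl
      map_smul' := by
        intro c x
        simp only [RingHom.id_apply]
        rw [← B.map_smul]
        congr 1
        apply Subtype.ext
        change A _ = c • A _
        rw [← A.map_smul]
        rfl }

/-- The powers `B ^ n` of an unbounded operator, each on its maximal domain;
`B ^ 0` is the identity on the whole space. -/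
def powMax {X : Type*} [AddCommGroup X] [Module ℂ X] (B : X →ₗ.[ℂ] X) : ℕ → (X →ₗ.[ℂ] X)
  | 0 => LinearMap.toPMap LinearMap.id ⊤
  | n + 1 => compMax B (powMax B n)

/-- The operator `z - A` with domain `D(A)`. -/
def scalarSub {X : Type*} [AddCommGroup X] [Module ℂ X] (z : ℂ) (A : X →ₗ.[ℂ] X) :
    X →ₗ.[ℂ] X where
  domain := A.domain
  toFun := z • A.domain.subtype - A.toFun

/-- `R` is a bounded everywhere defined two-sided inverse of `z - A : D(A) → X`. -/
def IsResolvent {X : Type*} [NormedAddCommGroup X] [NormedSpace ℂ X]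
    (A : X →ₗ.[ℂ] X) (z : ℂ) (R : X →L[ℂ] X) : Prop :=
  (∀ x : X, ∃ h : R x ∈ A.domain, scalarSub z A ⟨R x, h⟩ = x) ∧
    ∀ x : A.domain, R (scalarSub z A x) = x

/-- The resolvent set of `A`. -/
def resolventSet {X : Type*} [NormedAddCommGroup X] [NormedSpace ℂ X]
    (A : X →ₗ.[ℂ] X) : Set ℂ :=
  {z | ∃ R : X →L[ℂ] X, IsResolvent A z R}

open Classical in
/-- The resolvent `(z - A)⁻¹` (with the value `0` if `z` is not in the resolvent set). -/
def resolvent {X : Type*} [NormedAddCommGroup X] [NormedSpace ℂ X]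
    (A : X →ₗ.[ℂ] X) (z : ℂ) : X →L[ℂ] X :=
  if h : ∃ R : X →L[ℂ] X, IsResolvent A z R then h.choose else 0

/-- The resolvent is the only bounded inverse of `z - A`. -/
theorem IsResolvent.eq_resolvent {X : Type*} [NormedAddCommGroup X] [NormedSpace ℂ X]
    {A : X →ₗ.[ℂ] X} {z : ℂ} {R : X →L[ℂ] X} (hR : IsResolvent A z R) :
    R = resolvent A z := by
  have h : ∃ R : X →L[ℂ] X, IsResolvent A z R := ⟨R, hR⟩
  have hres : IsResolvent A z (resolvent A z) := by
    rw [resolvent, dif_pos h]; exact h.choose_spec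
  ext x
  obtain ⟨hx, hx'⟩ := hres.1 x
  exact (congrArg R hx'.symm).trans (hR.2 ⟨resolvent A z x, hx⟩)

/-- The Krylov space `K_n(R, v) = span {v, R v, …, R ^ (n - 1) v}`. -/
def krylov {X : Type*} [NormedAddCommGroup X] [NormedSpace ℂ X]
    (R : X →L[ℂ] X) (v : X) (n : ℕ) : Submodule ℂ X :=
  Submodule.span ℂ {w | ∃ k : ℕ, k < n ∧ w = (R ^ k) v}

/-- The maximal Krylov space `K_∞(R, v) = span {v, R v, R ^ 2 v, …}`. -/
def krylovMax {X : Type*} [NormedAddCommGroup X] [NormedSpace ℂ X]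
    (R : X →L[ℂ] X) (v : X) : Submodule ℂ X :=
  Submodule.span ℂ (Set.range fun k : ℕ => (R ^ k) v)

end PartialOperators

/-! ### Bounded strongly continuous semigroups and their generators -/

section Semigroups

/-- A bounded strongly continuous (`C₀`-) semigroup of bounded operators. -/
structure BoundedC0Semigroup (X : Type*) [NormedAddCommGroup X] [NormedSpace ℂ X] where
  /-- The operator `e^{tA}` at time `t ≥ 0`. -/
  op : ℝ≥0 → X →L[ℂ] X
  op_zero : op 0 = 1
  op_add : ∀ s t : ℝ≥0, op (s + t) = op s * op t
  continuous_orbit : ∀ x : X, Continuous fun t : ℝ≥0 => op t x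
  bounded : ∃ N : ℝ, ∀ t : ℝ≥0, ‖op t‖ ≤ N

/-- The generator: `A x = lim_{h ↓ 0} h⁻¹ (e^{hA} x - x)`, on the domain of all `x` for which
the limit exists. -/
def BoundedC0Semigroup.generator {X : Type*} [NormedAddCommGroup X] [NormedSpace ℂ X]
    (S : BoundedC0Semigroup X) : X →ₗ.[ℂ] X where
  domain :=
    { carrier := {x | ∃ y, Tendsto (fun h : ℝ≥0 => ((h : ℝ) : ℂ)⁻¹ • (S.op h x - x))
        (𝓝[>] 0) (𝓝 y)}
      zero_mem' := ⟨0, by simp⟩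
      add_mem' := by
        rintro a b ⟨y, hy⟩ ⟨z, hz⟩
        refine ⟨y + z, (hy.add hz).congr fun h => ?_⟩
        rw [← smul_add, map_add]; congr 1; abel
      smul_mem' := by
        rintro c a ⟨y, hy⟩
        refine ⟨c • y, (hy.const_smul c).congr fun h => ?_⟩
        rw [smul_comm, map_smul, smul_sub] }
  toFun :=
    { toFun := fun x => x.2.choose
      map_add' := by
        intro a b
        have h : Tendsto (fun h : ℝ≥0 => ((h : ℝ) : ℂ)⁻¹ • (S.op h (a.1 + b.1) - (a.1 + b.1)))
            (𝓝[>] 0) (𝓝 (a.2.choose + b.2.choose)) := by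
          refine (a.2.choose_spec.add b.2.choose_spec).congr fun h => ?_
          rw [← smul_add, map_add]; congr 1; abel
        exact tendsto_nhds_unique (a + b).2.choose_spec h
      map_smul' := by
        intro c a
        have h : Tendsto (fun h : ℝ≥0 => ((h : ℝ) : ℂ)⁻¹ • (S.op h (c • a.1) - c • a.1))
            (𝓝[>] 0) (𝓝 (c • a.2.choose)) := by
          refine (a.2.choose_spec.const_smul c).congr fun h => ?_
          rw [smul_comm, map_smul, smul_sub]
        exact tendsto_nhds_unique (c • a).2.choose_spec h }

end Semigroups

/-! ### The Fourier transform and the function classes -/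

section FunctionClasses

/-- The Fourier transform `(F φ)(s) = (2π)⁻¹ ∫ e^{-ixs} φ(x) dx`. -/
def fourierT (φ : ℝ → ℂ) (s : ℝ) : ℂ :=
  (1 / (2 * Real.pi) : ℂ) * ∫ x : ℝ, Complex.exp (-(Complex.I * x * s)) * φ x

/-- `g ∈ L¹(ℝ)` is the Fourier transform of `h` in the sense of tempered distributions:
`h` is integrable against Schwartz functions and `⟨h, F φ⟩ = ⟨g, φ⟩` for all Schwartz `φ`. -/
def HasFourierL1 (h g : ℝ → ℂ) : Prop :=
  Integrable g ∧ ∀ φ : 𝓢(ℝ, ℂ),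
    Integrable (fun x => h x * fourierT φ x) ∧
      ∫ x, h x * fourierT φ x = ∫ s, g s * φ s

/-- The class `M₊`: continuous functions on `ℝ` with Fourier transform in `L¹(ℝ)` supported in
`[0, ∞)`. -/
def classMPlus : Set (ℝ → ℂ) :=
  {h | Continuous h ∧ ∃ g, HasFourierL1 h g ∧ ∀ᵐ s : ℝ, s < 0 → g s = 0}

open Classical in
/-- The Fourier transform of `h` as an `L¹` function, if it is one (unique a.e.);
the value is `0` otherwise. -/
def fourierL1 (h : ℝ → ℂ) : ℝ → ℂ :=
  if H : ∃ g, HasFourierL1 h g then H.choose else 0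

theorem integrable_fourierL1 (h : ℝ → ℂ) : Integrable (fourierL1 h) := by
  unfold fourierL1
  split_ifs with H
  · exact H.choose_spec.1
  · exact integrable_zero _ _ _

/-- The restriction `f₍₀₎(ξ) = f(iξ)` to the imaginary axis. -/
def restrictIm (f : ℂ → ℂ) (ξ : ℝ) : ℂ := f (Complex.I * ξ)

/-- `f` is holomorphic in the open left half-plane and continuous on the closed one. The values of
`f` at points with positive real part play no role. -/
def HolomorphicLeft (f : ℂ → ℂ) : Prop := DiffContOnCl ℂ f {z | z.re < 0}

/-- The algebra `M̃`: functions holomorphic and bounded for `Re z ≤ 0` whose restriction to the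
imaginary axis lies in `M₊`. -/
def classMTilde : Set (ℂ → ℂ) :=
  {f | HolomorphicLeft f ∧ (∃ C : ℝ, ∀ z : ℂ, z.re ≤ 0 → ‖f z‖ ≤ C) ∧ restrictIm f ∈ classMPlus}

/-- The function `z ↦ f(z) / (1 - z) ^ n`. -/
def regularize (f : ℂ → ℂ) (n : ℕ) (z : ℂ) : ℂ := f z / (1 - z) ^ n

/-- The class `M₀`: functions holomorphic for `Re z ≤ 0` such that `f(z) / (1 - z) ^ n ∈ M̃` for
some `n`. -/
def classM0 : Set (ℂ → ℂ) :=
  {f | HolomorphicLeft f ∧ ∃ n : ℕ, regularize f n ∈ classMTilde}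

end FunctionClasses

/-! ### The functional calculus -/

section Calculus

/-- The integrand of the functional calculus is Bochner integrable. -/
theorem integrable_orbit {X : Type*} [NormedAddCommGroup X] [NormedSpace ℂ X]
    (S : BoundedC0Semigroup X) {g : ℝ → ℂ} (hg : Integrable g) (x : X) :
    Integrable (fun s : ℝ => g s • S.op s.toNNReal x) (volume.restrict (Set.Ioi 0)) := by
  obtain ⟨N, hN⟩ := S.bounded
  refine hg.restrict.smul_bdd (N * ‖x‖) ?_ ?_
  · exact ((S.continuous_orbit x).comp continuous_real_toNNReal).aestronglyMeasurable
  · exact Eventually.of_forall fun s =>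
      ((S.op s.toNNReal).le_opNorm x).trans (by gcongr; exact hN _)

/-- The operator `f(A) = ∫₀^∞ e^{sA} (F f₍₀₎)(s) ds` for `f ∈ M̃`, the integral being taken in the
strong sense. -/
def calcTilde {X : Type*} [NormedAddCommGroup X] [NormedSpace ℂ X]
    (S : BoundedC0Semigroup X) (f : ℂ → ℂ) : X →L[ℂ] X :=
  LinearMap.mkContinuousOfExistsBound
    { toFun := fun x => ∫ s in Set.Ioi (0 : ℝ), fourierL1 (restrictIm f) s • S.op s.toNNReal x
      map_add' := by
        intro x y
        rw [← integral_add (integrable_orbit S (integrable_fourierL1 _) x)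
          (integrable_orbit S (integrable_fourierL1 _) y)]
        simp only [map_add, smul_add]
      map_smul' := by
        intro c x
        rw [RingHom.id_apply, ← integral_smul]
        simp only [map_smul, smul_comm c] }
    (by
      obtain ⟨N, hN⟩ := S.bounded
      refine ⟨(∫ s in Set.Ioi (0 : ℝ), ‖fourierL1 (restrictIm f) s‖) * N, fun x => ?_⟩
      rw [mul_assoc, ← integral_mul_const]
      refine norm_integral_le_of_norm_le
        ((integrable_fourierL1 (restrictIm f)).norm.restrict.mul_const (N * ‖x‖))
        (Eventually.of_forall fun s => ?_)
      rw [norm_smul]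
      gcongr
      exact ((S.op s.toNNReal).le_opNorm x).trans (by gcongr; exact hN _))

/-- The operator `(1 - A) ^ n (f(z) / (1 - z) ^ n)(A)` on its natural domain, `A` being the generator
of `S`. -/
def calcReg {X : Type*} [NormedAddCommGroup X] [NormedSpace ℂ X]
    (S : BoundedC0Semigroup X) (f : ℂ → ℂ) (n : ℕ) : X →ₗ.[ℂ] X :=
  compMax (powMax (scalarSub 1 S.generator) n)
    (LinearMap.toPMap (calcTilde S (regularize f n) : X →ₗ[ℂ] X) ⊤)

/-- The (in general unbounded) operator `f(A)` for `f ∈ M₀`. It does not depend on the choice of an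
admissible `n`; the least one is taken. -/
def calc0 {X : Type*} [NormedAddCommGroup X] [NormedSpace ℂ X]
    (S : BoundedC0Semigroup X) (f : ℂ → ℂ) : X →ₗ.[ℂ] X :=
  calcReg S f (sInf {n : ℕ | regularize f n ∈ classMTilde})

/-- The class `M` of all `f ∈ M₀` for which `f(A)` is a bounded operator defined on all of `X`. -/
def classM {X : Type*} [NormedAddCommGroup X] [NormedSpace ℂ X]
    (S : BoundedC0Semigroup X) : Set (ℂ → ℂ) :=
  {f | f ∈ classM0 ∧ (∀ x : X, x ∈ (calc0 S f).domain) ∧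
    ∃ C : ℝ, ∀ x : (calc0 S f).domain, ‖calc0 S f x‖ ≤ C * ‖(x : X)‖}

/-- The bounded operator `f(A) : X → X` for `f ∈ M`. -/
def opOf {X : Type*} [NormedAddCommGroup X] [NormedSpace ℂ X]
    (S : BoundedC0Semigroup X) (f : ℂ → ℂ) (hf : f ∈ classM S) : X →L[ℂ] X :=
  LinearMap.mkContinuousOfExistsBound
    { toFun := fun x => calc0 S f ⟨x, hf.2.1 x⟩
      map_add' := fun x y => (calc0 S f).map_add ⟨x, hf.2.1 x⟩ ⟨y, hf.2.1 y⟩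
      map_smul' := fun c x => (calc0 S f).map_smul c ⟨x, hf.2.1 x⟩ }
    (by
      obtain ⟨C, hC⟩ := hf.2.2
      exact ⟨C, fun x => hC ⟨x, hf.2.1 x⟩⟩)

end Calculus

end

end ResolventKrylov

namespace ResolventKrylov

section

variable {X : Type*} [NormedAddCommGroup X] [NormedSpace ℂ X]

/-! ### Laplace transforms of orbits -/

/-! Let `W` be the closure of the Krylov space. It is closed, contains `v` and is invariant under
`(γ - A)⁻¹`; the point is that it is then invariant under every `e^{tA}`. For `Re z > 0` the
resolvent is the Laplace transform of the semigroup (`isResolvent_laplace`). On the line `Re z = γ`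
the resolvents are uniformly bounded, so invariance of `W` spreads along the whole line in steps of
fixed length (`laplace_mem_of_vertical`). Hence, for `x ∈ W`, the function `e^{-γt} e^{tA} x` on `t
> 0`, read modulo `W`, has Fourier transform zero, and Fourier inversion gives `e^{tA} x ∈ W`
(`op_mem_of_laplace_mem`). The operator `f(A)` is built from the semigroup by integrals, limits and
linear combinations, all of which preserve a closed invariant subspace (`calc0_mem`). -/

theorem norm_cexp_neg_mul_ofReal (z : ℂ) (t : ℝ) :
    ‖Complex.exp (-(z * t))‖ = Real.exp (-z.re * t) := by
  simp [Complex.norm_exp]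

theorem integrableOn_cexp_neg_mul {z : ℂ} (hz : 0 < z.re) :
    IntegrableOn (fun t : ℝ => Complex.exp (-(z * t))) (Set.Ioi 0) := by
  have h := integrableOn_exp_mul_complex_Ioi (a := -z) (by simpa using hz) 0
  simpa using h

theorem continuous_orbit_toNNReal (S : BoundedC0Semigroup X) (x : X) :
    Continuous fun t : ℝ => S.op t.toNNReal x :=
  (S.continuous_orbit x).comp continuous_real_toNNReal

theorem integrable_laplace (S : BoundedC0Semigroup X) {z : ℂ} (hz : 0 < z.re) (x : X) :
    IntegrableOn (fun t : ℝ => Complex.exp (-(z * t)) • S.op t.toNNReal x) (Set.Ioi 0) := by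
  obtain ⟨N, hN⟩ := S.bounded
  refine (integrableOn_cexp_neg_mul hz).smul_bdd (N * ‖x‖)
    (continuous_orbit_toNNReal S x).aestronglyMeasurable (Eventually.of_forall fun s => ?_)
  exact ((S.op s.toNNReal).le_opNorm x).trans (by gcongr; exact hN _)

theorem norm_laplace_le (S : BoundedC0Semigroup X) {N : ℝ} (hN : ∀ t, ‖S.op t‖ ≤ N) {z : ℂ}
    (hz : 0 < z.re) (x : X) :
    ‖∫ t in Set.Ioi (0 : ℝ), Complex.exp (-(z * t)) • S.op t.toNNReal x‖ ≤
      ((∫ t in Set.Ioi (0 : ℝ), Real.exp (-z.re * t)) * N) * ‖x‖ := by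
  rw [mul_assoc, ← integral_mul_const]
  refine norm_integral_le_of_norm_le ((integrableOn_exp_mul_Ioi (neg_lt_zero.2 hz) 0).mul_const _)
    (Eventually.of_forall fun s => ?_)
  rw [norm_smul, norm_cexp_neg_mul_ofReal]
  gcongr
  exact ((S.op s.toNNReal).le_opNorm x).trans (by gcongr; exact hN _)

/-- The Laplace transform `∫₀^∞ e^{-zt} e^{tA} dt` of a bounded semigroup, for `Re z > 0`. -/
noncomputable def laplace (S : BoundedC0Semigroup X) {z : ℂ} (hz : 0 < z.re) : X →L[ℂ] X :=
  LinearMap.mkContinuousOfExistsBound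
    { toFun := fun x => ∫ t in Set.Ioi (0 : ℝ), Complex.exp (-(z * t)) • S.op t.toNNReal x
      map_add' := by
        intro x y
        rw [← integral_add (integrable_laplace S hz x) (integrable_laplace S hz y)]
        simp only [map_add, smul_add]
      map_smul' := by
        intro c x
        rw [RingHom.id_apply, ← integral_smul]
        simp only [map_smul, smul_comm c] }
    (by
      obtain ⟨N, hN⟩ := S.bounded
      exact ⟨_, norm_laplace_le S hN hz⟩)

theorem laplace_apply (S : BoundedC0Semigroup X) {z : ℂ} (hz : 0 < z.re) (x : X) :
    laplace S hz x = ∫ t in Set.Ioi (0 : ℝ), Complex.exp (-(z * t)) • S.op t.toNNReal x :=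
  rfl

/-- Substituting `t ↦ t + h` turns the left side into `e^{zh}` times the integral over `(h, ∞)`.
Writing that tail as a difference makes the dependence on `h` visibly differentiable. -/
theorem op_laplace [CompleteSpace X] (S : BoundedC0Semigroup X) {z : ℂ} (hz : 0 < z.re) (x : X)
    (h : ℝ≥0) :
    S.op h (laplace S hz x) = Complex.exp (z * (h : ℝ)) •
      (laplace S hz x - ∫ t in (0 : ℝ)..h, Complex.exp (-(z * t)) • S.op t.toNNReal x) := by
  have hint := integrable_laplace S hz x
  have hsplit : laplace S hz x - ∫ t in (0 : ℝ)..h, Complex.exp (-(z * t)) • S.op t.toNNReal x =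
      ∫ t in Set.Ioi (h : ℝ), Complex.exp (-(z * t)) • S.op t.toNNReal x := by
    rw [intervalIntegral.integral_of_le h.coe_nonneg, laplace_apply,
      ← Set.Ioc_union_Ioi_eq_Ioi h.coe_nonneg, setIntegral_union
        (Set.Ioc_disjoint_Ioi le_rfl) measurableSet_Ioi
        (hint.mono_set Set.Ioc_subset_Ioi_self) (hint.mono_set (Set.Ioi_subset_Ioi h.coe_nonneg))]
    abel
  rw [hsplit, laplace_apply, ← (S.op h).integral_comp_comm hint, ← integral_smul]
  have hshift := (measurePreserving_add_right volume (h : ℝ)).setIntegral_preimage_emb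
    (measurableEmbedding_addRight (h : ℝ))
    (fun t : ℝ => Complex.exp (z * (h : ℝ)) • Complex.exp (-(z * t)) • S.op t.toNNReal x)
    (Set.Ioi (h : ℝ))
  rw [Set.preimage_add_const_Ioi, sub_self] at hshift
  rw [← hshift]
  refine setIntegral_congr_fun measurableSet_Ioi fun t ht => ?_
  have ht' : (t + h).toNNReal = h + t.toNNReal := by
    rw [Real.toNNReal_add (le_of_lt ht) h.coe_nonneg, Real.toNNReal_coe, add_comm]
  simp only [map_smul, ht', S.op_add, mul_apply_eq_comp, smul_smul, ← Complex.exp_add]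
  congr 2
  push_cast
  ring

/-- This is the product rule at `h = 0` applied to the formula of `op_laplace`. -/
theorem tendsto_diffQuot_laplace [CompleteSpace X] (S : BoundedC0Semigroup X) {z : ℂ}
    (hz : 0 < z.re) (x : X) :
    Tendsto (fun h : ℝ≥0 => ((h : ℝ) : ℂ)⁻¹ • (S.op h (laplace S hz x) - laplace S hz x))
      (𝓝[>] 0) (𝓝 (z • laplace S hz x - x)) := by
  have hcont : Continuous fun t : ℝ => Complex.exp (-(z * t)) • S.op t.toNNReal x :=
    (by fun_prop : Continuous fun t : ℝ => Complex.exp (-(z * t))).smul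
      (continuous_orbit_toNNReal S x)
  have h1 : HasDerivAt
      (fun h : ℝ => ∫ t in (0 : ℝ)..h, Complex.exp (-(z * t)) • S.op t.toNNReal x) x 0 := by
    have := intervalIntegral.integral_hasDerivAt_right (hcont.intervalIntegrable 0 0)
      hcont.stronglyMeasurable.stronglyMeasurableAtFilter hcont.continuousAt
    simpa [S.op_zero] using this
  have h2 : HasDerivAt (fun h : ℝ => Complex.exp (z * h)) z 0 := by
    have := ((hasDerivAt_id (0 : ℂ)).const_mul z).cexp.comp_ofReal
    simpa using this
  have h3 := h2.smul (h1.const_sub (laplace S hz x))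
  have h4 := h3.tendsto_slope_zero_right
  have h5 : Tendsto (fun h : ℝ≥0 => (h : ℝ)) (𝓝[>] 0) (𝓝[>] 0) := by
    refine tendsto_nhdsWithin_iff.2 ⟨?_, ?_⟩
    · exact (NNReal.continuous_coe.tendsto' 0 0 rfl).mono_left nhdsWithin_le_nhds
    · exact eventually_mem_nhdsWithin.mono fun h hh => NNReal.coe_pos.2 hh
  have h6 := h4.comp h5
  have h7 : Complex.exp (z * ((0 : ℝ) : ℂ)) • -x + z •
      (laplace S hz x - ∫ t in (0 : ℝ)..0, Complex.exp (-(z * t)) • S.op t.toNNReal x) =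
      z • laplace S hz x - x := by
    simp; abel
  rw [h7] at h6
  refine h6.congr fun h => ?_
  simp only [Function.comp_apply, zero_add, Pi.smul_apply', op_laplace]
  rw [← Complex.ofReal_inv, Complex.coe_smul]
  simp

/-! ### The generator -/

theorem generator_spec (S : BoundedC0Semigroup X) (x : S.generator.domain) :
    Tendsto (fun h : ℝ≥0 => ((h : ℝ) : ℂ)⁻¹ • (S.op h x - x)) (𝓝[>] 0)
      (𝓝 (S.generator x)) :=
  x.2.choose_spec

theorem generator_eq (S : BoundedC0Semigroup X) {x y : X}
    (h : Tendsto (fun h : ℝ≥0 => ((h : ℝ) : ℂ)⁻¹ • (S.op h x - x)) (𝓝[>] 0) (𝓝 y)) :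
    ∃ hx : x ∈ S.generator.domain, S.generator ⟨x, hx⟩ = y :=
  ⟨⟨y, h⟩, tendsto_nhds_unique (generator_spec S ⟨x, ⟨y, h⟩⟩) h⟩

theorem scalarSub_apply (z : ℂ) (A : X →ₗ.[ℂ] X) (x : A.domain) :
    scalarSub z A x = z • (x : X) - A x := rfl

theorem op_comm (S : BoundedC0Semigroup X) (s t : ℝ≥0) (x : X) :
    S.op s (S.op t x) = S.op t (S.op s x) := by
  rw [← mul_apply_eq_comp, ← mul_apply_eq_comp, ← S.op_add, ← S.op_add,
    add_comm]

theorem laplace_op [CompleteSpace X] (S : BoundedC0Semigroup X) {z : ℂ} (hz : 0 < z.re) (h : ℝ≥0)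
    (x : X) : laplace S hz (S.op h x) = S.op h (laplace S hz x) := by
  rw [laplace_apply, laplace_apply, ← (S.op h).integral_comp_comm (integrable_laplace S hz x)]
  simp only [map_smul, op_comm S h]

theorem isResolvent_laplace [CompleteSpace X] (S : BoundedC0Semigroup X) {z : ℂ}
    (hz : 0 < z.re) : IsResolvent S.generator z (laplace S hz) := by
  constructor
  · intro x
    obtain ⟨hx, hAx⟩ := generator_eq S (tendsto_diffQuot_laplace S hz x)
    refine ⟨hx, ?_⟩
    refine (scalarSub_apply z S.generator ⟨_, hx⟩).trans ?_
    rw [hAx]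
    abel
  · intro x
    -- Left inverse: the Laplace transform commutes with the difference quotients, so uniqueness of
    -- limits lets it commute with the generator.
    have h1 := ((laplace S hz).continuous.tendsto _).comp (generator_spec S x)
    have h2 : laplace S hz (S.generator x) = z • laplace S hz (x : X) - x := by
      refine tendsto_nhds_unique h1 ((tendsto_diffQuot_laplace S hz (x : X)).congr fun h => ?_)
      simp only [Function.comp_apply, map_smul, map_sub, laplace_op]
    rw [scalarSub_apply, map_sub, map_smul, h2]
    abel

/-- The resolvent identity. -/
theorem IsResolvent.sub_eq {A : X →ₗ.[ℂ] X} {z w : ℂ} {R Q : X →L[ℂ] X}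
    (hR : IsResolvent A z R) (hQ : IsResolvent A w Q) (x : X) :
    Q x = R x + (z - w) • R (Q x) := by
  obtain ⟨hx, hQx⟩ := hQ.1 x
  have h := hR.2 ⟨Q x, hx⟩
  have h' : scalarSub z A ⟨Q x, hx⟩ = x + (z - w) • Q x := by
    have hw : w • Q x - A ⟨Q x, hx⟩ = x := hQx
    refine (scalarSub_apply z A ⟨Q x, hx⟩).trans ?_
    nth_rewrite 3 [← hw]
    module
  rw [← map_smul, ← map_add, ← h']
  exact h.symm

/-! ### Invariant subspaces -/

/-- Invariance of a closed subspace under a resolvent passes to nearby resolvents. -/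
theorem IsResolvent.mapsTo_of_near {A : X →ₗ.[ℂ] X} {z w : ℂ} {R Q : X →L[ℂ] X}
    (hR : IsResolvent A z R) (hQ : IsResolvent A w Q) {W : Submodule ℂ X}
    (hW : IsClosed (W : Set X)) (hinv : ∀ x ∈ W, R x ∈ W) (hnear : ‖z - w‖ * ‖R‖ < 1) :
    ∀ x ∈ W, Q x ∈ W := by
  intro x hx
  have hne : (W : Set X).Nonempty := ⟨0, W.zero_mem⟩
  -- `Q x` is the fixed point of `y ↦ R x + (z - w) R y`, which maps `W` to itself and contracts by
  -- `‖z - w‖ ‖R‖ < 1`. So the distance from `Q x` to `W` is at most a proper fraction of itself.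
  have key : Metric.infDist (Q x) W ≤ ‖z - w‖ * ‖R‖ * Metric.infDist (Q x) W := by
    have hbound : ∀ y ∈ (W : Set X), Metric.infDist (Q x) W ≤ ‖z - w‖ * ‖R‖ * dist (Q x) y := by
      intro y hy
      have hmem : R x + (z - w) • R y ∈ W := W.add_mem (hinv x hx) (W.smul_mem _ (hinv y hy))
      refine (Metric.infDist_le_dist_of_mem hmem).trans ?_
      nth_rewrite 1 [hR.sub_eq hQ x]
      rw [dist_add_left, dist_eq_norm, ← smul_sub, ← map_sub, norm_smul, dist_eq_norm, mul_assoc]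
      gcongr
      exact R.le_opNorm _
    rcases (by positivity : 0 ≤ ‖z - w‖ * ‖R‖).eq_or_lt with h0 | hpos
    · have := hbound 0 W.zero_mem
      simpa [← h0] using this
    · rw [mul_comm, ← div_le_iff₀ hpos]
      refine (Metric.le_infDist hne).2 fun {y} hy => ?_
      rw [div_le_iff₀ hpos, mul_comm]
      exact hbound y hy
  have h0 : Metric.infDist (Q x) W = 0 := by
    nlinarith [Metric.infDist_nonneg (x := Q x) (s := (W : Set X))]
  exact (hW.mem_iff_infDist_zero hne).2 h0

/-- The resolvents along a vertical line preserve every closed subspace that one of them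
preserves. -/
theorem laplace_mem_of_vertical [CompleteSpace X] (S : BoundedC0Semigroup X) {γ : ℝ} (hγ : 0 < γ)
    {W : Submodule ℂ X} (hW : IsClosed (W : Set X))
    (hinv : ∀ x ∈ W, laplace S (z := γ) (by simpa using hγ) x ∈ W) (ξ : ℝ) :
    ∀ x ∈ W, laplace S (z := γ + ξ * Complex.I) (by simpa using hγ) x ∈ W := by
  obtain ⟨N, hN⟩ := S.bounded
  have hN0 : 0 ≤ N := (norm_nonneg _).trans (hN 0)
  have hre : ∀ η : ℝ, 0 < ((γ : ℂ) + η * Complex.I).re := fun η => by simpa using hγ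
  -- This bound depends on `Re z = γ` only, so the admissible step length is the same all along the
  -- line.
  set C : ℝ := (∫ t in Set.Ioi (0 : ℝ), Real.exp (-γ * t)) * N with hC
  have hC0 : 0 ≤ C :=
    mul_nonneg (integral_nonneg fun t => (Real.exp_pos _).le) hN0
  have hbound : ∀ η : ℝ, ‖laplace S (hre η)‖ ≤ C := fun η =>
    ContinuousLinearMap.opNorm_le_bound _ hC0 fun x => by
      simpa [hC, laplace_apply] using norm_laplace_le S hN (hre η) x
  have hstep : ∀ η ζ : ℝ, |η - ζ| * C < 1 → (∀ x ∈ W, laplace S (hre η) x ∈ W) →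
      ∀ x ∈ W, laplace S (hre ζ) x ∈ W := by
    intro η ζ hlt h
    refine (isResolvent_laplace S (hre η)).mapsTo_of_near (isResolvent_laplace S (hre ζ)) hW h ?_
    have : ‖((γ : ℂ) + η * Complex.I) - (γ + ζ * Complex.I)‖ = |η - ζ| := by
      rw [add_sub_add_left_eq_sub, ← sub_mul, ← Complex.ofReal_sub, norm_mul, Complex.norm_I,
        mul_one, Complex.norm_real, Real.norm_eq_abs]
    rw [this]
    exact (mul_le_mul_of_nonneg_left (hbound η) (abs_nonneg _)).trans_lt hlt
  -- The segment from `γ` to `γ + iξ` is cut into `m` equal steps, each short enough for `hstep`.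
  obtain ⟨m, hm⟩ := exists_nat_gt (|ξ| * C)
  have hm0 : (0 : ℝ) < m := (mul_nonneg (abs_nonneg _) hC0).trans_lt hm
  have hall : ∀ k : ℕ, ∀ x ∈ W, laplace S (hre (k * (ξ / m))) x ∈ W := by
    intro k
    induction k with
    | zero =>
      intro x hx
      have := hinv x hx
      rw [laplace_apply] at this ⊢
      simpa using this
    | succ k ih =>
      refine hstep _ _ ?_ ih
      have : (k : ℝ) * (ξ / m) - ((k + 1 : ℕ) : ℝ) * (ξ / m) = -(ξ / m) := by push_cast; ring
      rw [this, abs_neg, abs_div, abs_of_pos hm0, div_mul_eq_mul_div, div_lt_one hm0]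
      exact hm
  intro x hx
  have := hall m x hx
  rw [laplace_apply] at this ⊢
  rwa [mul_div_cancel₀ ξ hm0.ne'] at this

open scoped FourierTransform in
/-- A closed subspace preserved by a resolvent `(γ - A)⁻¹`, `γ > 0`, is preserved by the
semigroup. -/
theorem op_mem_of_laplace_mem [CompleteSpace X] (S : BoundedC0Semigroup X) {γ : ℝ} (hγ : 0 < γ)
    {W : Submodule ℂ X} (hW : IsClosed (W : Set X))
    (hinv : ∀ x ∈ W, laplace S (z := γ) (by simpa using hγ) x ∈ W) (t : ℝ≥0) :
    ∀ x ∈ W, S.op t x ∈ W := by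
  intro x hx
  rcases eq_or_ne t 0 with rfl | ht
  · simpa [S.op_zero] using hx
  have htpos : (0 : ℝ) < t := NNReal.coe_pos.2 (pos_iff_ne_zero.2 ht)
  -- As an instance, this makes `X ⧸ W` a normed space.
  have : IsClosed (W : Set X) := hW
  have hγ' : 0 < (γ : ℂ).re := by simpa using hγ
  let F : ℝ → X ⧸ W := (Set.Ioi (0 : ℝ)).indicator
    fun s => W.mkQL (Complex.exp (-(γ * s)) • S.op s.toNNReal x)
  have hFint : Integrable F :=
    (integrable_indicator_iff measurableSet_Ioi).2
      (W.mkQL.integrable_comp (integrable_laplace S hγ' x))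
  have hFF : 𝓕 F = 0 := by
    ext ξ
    have hre : 0 < ((γ : ℂ) + (2 * Real.pi * ξ : ℝ) * Complex.I).re := by simpa using hγ
    have hmem := laplace_mem_of_vertical S hγ hW hinv (2 * Real.pi * ξ) x hx
    have h1 : W.mkQL (laplace S hre x) = 0 := (Submodule.Quotient.mk_eq_zero W).2 hmem
    rw [laplace_apply, ← W.mkQL.integral_comp_comm (integrable_laplace S hre x)] at h1
    -- The transform of `F` at `ξ` is the class of the resolvent at `γ + 2πiξ` applied to `x`; the
    -- factor `2π` comes from the kernel `e^{-2πisξ}`.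
    rw [Real.fourier_eq', Pi.zero_apply, ← h1, ← integral_indicator measurableSet_Ioi]
    congr 1
    ext s
    by_cases hs : s ∈ Set.Ioi (0 : ℝ)
    · simp only [F, Set.indicator_of_mem hs, map_smul, smul_smul, ← Complex.exp_add]
      congr 2
      simp
      ring
    · simp only [F, Set.indicator_of_notMem hs, smul_zero]
  -- Pointwise inversion needs continuity at `t`. The cutoff may make `F` jump at `0`, which is why
  -- `t = 0` was treated apart.
  have hFcont : ContinuousAt F t := by
    have hc : Continuous fun s : ℝ => W.mkQL (Complex.exp (-(γ * s)) • S.op s.toNNReal x) :=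
      W.mkQL.continuous.comp ((by fun_prop : Continuous fun s : ℝ => Complex.exp (-(γ * s))).smul
        (continuous_orbit_toNNReal S x))
    refine hc.continuousAt.congr ?_
    filter_upwards [Ioi_mem_nhds htpos] with s hs
    simp only [F, Set.indicator_of_mem hs]
  have hinvF := hFint.fourierInv_fourier_eq (by rw [hFF]; exact integrable_zero _ _ _) hFcont
  have h0 : F t = 0 := by
    rw [← hinvF, hFF, Real.fourierInv_eq']
    simp
  have h2 : W.mkQL (S.op t x) = 0 := by
    simp only [F] at h0
    rw [Set.indicator_of_mem (Set.mem_Ioi.2 htpos), map_smul, Real.toNNReal_coe] at h0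
    exact (smul_eq_zero.1 h0).resolve_left (Complex.exp_ne_zero _)
  exact (Submodule.Quotient.mk_eq_zero W).1 h2

/-! ### Invariance under the functional calculus -/

theorem generator_mem (S : BoundedC0Semigroup X) {W : Submodule ℂ X}
    (hW : IsClosed (W : Set X)) (hinv : ∀ t, ∀ x ∈ W, S.op t x ∈ W) (x : S.generator.domain)
    (hx : (x : X) ∈ W) : S.generator x ∈ W :=
  hW.mem_of_tendsto (generator_spec S x)
    (Eventually.of_forall fun h => W.smul_mem _ (W.sub_mem (hinv h _ hx) hx))

theorem powMax_mem {B : X →ₗ.[ℂ] X} {W : Submodule ℂ X}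
    (hB : ∀ x : B.domain, (x : X) ∈ W → B x ∈ W) (n : ℕ) :
    ∀ x : (powMax B n).domain, (x : X) ∈ W → powMax B n x ∈ W := by
  induction n with
  | zero => exact fun x hx => hx
  | succ n ih => exact fun x hx => hB _ (ih ⟨x.1, x.2.choose⟩ hx)

theorem calcTilde_mem [CompleteSpace X] (S : BoundedC0Semigroup X) {W : Submodule ℂ X}
    (hW : IsClosed (W : Set X)) (hinv : ∀ t, ∀ x ∈ W, S.op t x ∈ W) (f : ℂ → ℂ) {x : X}
    (hx : x ∈ W) : calcTilde S f x ∈ W := by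
  have : IsClosed (W : Set X) := hW
  have happ : calcTilde S f x =
    ∫ s in Set.Ioi (0 : ℝ), fourierL1 (restrictIm f) s • S.op s.toNNReal x := rfl
  refine (Submodule.Quotient.mk_eq_zero W).1 (?_ : W.mkQL (calcTilde S f x) = 0)
  rw [happ, ← W.mkQL.integral_comp_comm (integrable_orbit S (integrable_fourierL1 _) x)]
  -- The quotient map kills the integrand at every `s`, hence also the integral.
  refine integral_eq_zero_of_ae (Eventually.of_forall fun s => ?_)
  exact (Submodule.Quotient.mk_eq_zero W).2 (W.smul_mem _ (hinv _ _ hx))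

theorem calc0_mem [CompleteSpace X] (S : BoundedC0Semigroup X) {W : Submodule ℂ X}
    (hW : IsClosed (W : Set X)) (hinv : ∀ t, ∀ x ∈ W, S.op t x ∈ W) (f : ℂ → ℂ)
    (x : (calc0 S f).domain) (hx : (x : X) ∈ W) : calc0 S f x ∈ W :=
  powMax_mem (B := scalarSub 1 S.generator)
    (fun y hy => W.sub_mem (W.smul_mem _ hy) (generator_mem S hW hinv y hy)) _ _
    (calcTilde_mem S hW hinv _ hx)

/-! ### Krylov spaces -/

theorem apply_mem_krylovMax (R : X →L[ℂ] X) (v : X) {x : X} (hx : x ∈ krylovMax R v) :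
    R x ∈ krylovMax R v := by
  have h : krylovMax R v ≤ (krylovMax R v).comap (R : X →ₗ[ℂ] X) := by
    refine Submodule.span_le.2 ?_
    rintro _ ⟨k, rfl⟩
    refine Submodule.subset_span ⟨k + 1, ?_⟩
    simp [pow_succ']
  exact h hx

theorem apply_mem_closure_krylovMax (R : X →L[ℂ] X) (v : X) {x : X}
    (hx : x ∈ (krylovMax R v).topologicalClosure) :
    R x ∈ (krylovMax R v).topologicalClosure :=
  map_mem_closure R.continuous hx fun _ hy => apply_mem_krylovMax R v hy

theorem krylov_mono (R : X →L[ℂ] X) (v : X) : Monotone (krylov R v) := fun _ _ hmn =>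
  Submodule.span_mono fun _ ⟨k, hk, hw⟩ => ⟨k, hk.trans_le hmn, hw⟩

theorem krylovMax_eq_iSup (R : X →L[ℂ] X) (v : X) : krylovMax R v = ⨆ n, krylov R v n := by
  refine le_antisymm (Submodule.span_le.2 ?_) (iSup_le fun n => Submodule.span_mono ?_)
  · rintro _ ⟨k, rfl⟩
    exact Submodule.mem_iSup_of_mem (k + 1) (Submodule.subset_span ⟨k, k.lt_succ_self, rfl⟩)
  · rintro _ ⟨k, -, rfl⟩
    exact ⟨k, rfl⟩

/-- The spaces `krylov R v n` increase to `krylovMax R v`, so a single approximant lies in all of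
them from some index on. -/
theorem exists_krylov_near (R : X →L[ℂ] X) (v : X) {y : X}
    (hy : y ∈ closure (krylovMax R v : Set X)) {ε : ℝ} (hε : 0 < ε) :
    ∃ n₀ : ℕ, ∀ n : ℕ, n₀ ≤ n → ∃ w ∈ krylov R v n, ‖y - w‖ < ε := by
  obtain ⟨w, hw, hyw⟩ := Metric.mem_closure_iff.1 hy ε hε
  rw [SetLike.mem_coe, krylovMax_eq_iSup,
    Submodule.mem_iSup_of_directed _ (krylov_mono R v).directed_le] at hw
  obtain ⟨n₀, hn₀⟩ := hw
  exact ⟨n₀, fun n hn => ⟨w, krylov_mono R v hn hn₀, by rwa [← dist_eq_norm]⟩⟩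

end

end ResolventKrylov

theorem mainTheorem3 {X : Type*} [NormedAddCommGroup X] [NormedSpace ℂ X] [CompleteSpace X]
    (A : X →ₗ.[ℂ] X) (S : ResolventKrylov.BoundedC0Semigroup X) (hA : S.generator = A)
    (γ : ℝ) (hγ : 0 < γ) (f : ℂ → ℂ) (hf : f ∈ ResolventKrylov.classM S) (v : X) :
    (γ : ℂ) ∈ ResolventKrylov.resolventSet A ∧
    ResolventKrylov.opOf S f hf v ∈
      closure (ResolventKrylov.krylovMax (ResolventKrylov.resolvent A γ) v : Set X) ∧
    ∀ ε : ℝ, 0 < ε → ∃ n₀ : ℕ, ∀ n : ℕ, n₀ ≤ n →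
      ∃ w ∈ ResolventKrylov.krylov (ResolventKrylov.resolvent A γ) v n,
        ‖ResolventKrylov.opOf S f hf v - w‖ < ε := by

  subst hA
  have hγ' : 0 < (γ : ℂ).re := by simpa using hγ
  have hres := ResolventKrylov.isResolvent_laplace S hγ'
  have hcl : IsClosed ((ResolventKrylov.krylovMax
      (ResolventKrylov.resolvent S.generator γ) v).topologicalClosure : Set X) :=
    Submodule.isClosed_topologicalClosure _
  -- By uniqueness of the inverse, the Laplace transform at `γ` is the resolvent that generates the
  -- Krylov space.
  have hinv := ResolventKrylov.op_mem_of_laplace_mem S hγ hcl fun x hx => by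
    rw [hres.eq_resolvent]
    exact ResolventKrylov.apply_mem_closure_krylovMax _ v hx
  have hv : v ∈ (ResolventKrylov.krylovMax
      (ResolventKrylov.resolvent S.generator γ) v).topologicalClosure :=
    Submodule.le_topologicalClosure _ (Submodule.subset_span ⟨0, rfl⟩)
  have hmem : ResolventKrylov.opOf S f hf v ∈
      closure (ResolventKrylov.krylovMax (ResolventKrylov.resolvent S.generator γ) v : Set X) :=
    ResolventKrylov.calc0_mem S hcl hinv f ⟨v, hf.2.1 v⟩ hv
  exact ⟨⟨_, hres⟩, hmem, fun ε hε => ResolventKrylov.exists_krylov_near _ v hmem hε⟩
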